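/- Let $\{Z_t\}_{t\in\mathbb Z}$ be i.i.d. positive random variables with $E(Z_t)=1$ and density $f_Z$, let $(a_j)_{j\ge 0}$ be positive numbers, and let $\{X_t\}_{t\in\mathbb Z}$ be a nonnegative, strictly stationary ARCH($\infty$) process, i.e. almost surely $$X_t=Z_t\Big(a_0+\sum_{j=1}^\infty a_jX_{t-j}\Big),\qquad t\in\mathbb Z,$$ where $\{Z_s\}_{s>t}$ is independent of $\{X_s\}_{s\le t}$ for every $t$. Suppose that - for some finite constant $L$, $\int_{\mathbb R}|f_Z(u)-f_Z(u(1+x))|\,du\le Lx$ for all $x>0$; - $\sum_{j=1}^\infty a_j<1-d$ for some $d>0$; - $E|X_t|^\nu<\infty$ for some $\nu>1$. Let $(\psi_j)_{j\ge0}$ be the coefficients of $\big(1-\sum_{j\ge1}a_jz^j\big)^{-1}=\sum_{j\ge0}\psi_jz^j$ and put $K(\nu)=3\big(\nu^{1/(1+\nu)}+\nu^{-\nu/(\nu+1)}\big)$. Then for every $k\ge1$ $$\sup_{G\in\sigma(X_k),\,H\in\sigma(X_0,X_{-1},\dots)}|P(G\cap H)-P(G)P(H)|\le K(\nu)\,L^{\nu/(\nu+1)}\sum_{i=0}^\infty\Big[\frac1{a_0}\sum_{j=0}^{k-1}|\psi_j|\,a_{k-j+i}\Big]^{\nu/(\nu+1)}\big[E|X_0|^\nu\big]^{1/(\nu+1)},$$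 where the right-hand side may be $+\infty$. If moreover, for some real $\delta$, $a_j$ and $|\psi_j|$ are both of the exact order $j^{-\delta}$ (bounded above and below by positive constant multiples of $j^{-\delta}$ for all large $j$), then there is a finite constant $K$, not depending on $k$, such that for all $k\ge1$ $$\sup_{G\in\sigma(X_k),\,H\in\sigma(X_0,X_{-1},\dots)}|P(G\cap H)-P(G)P(H)|\le K\,k\,(k+1)^{-\tilde\delta+1},\qquad \tilde\delta=\frac{\delta\nu}{\nu+1},$$ and the 2-mixing rate $\tilde\alpha(k)=\sup_{t\in\mathbb Z}\sup_{H\in\sigma(X_t),\,G\in\sigma(X_{t+k})}|P(G\cap H)-P(G)P(H)|$ satisfies the same bound. -/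

import Mathlib

open MeasureTheory ProbabilityTheory Filter Asymptotics
open scoped ENNReal

/-- The sigma-algebra `σ(X t)` generated by one variable of a real process. -/
abbrev sigmaAt {Ω : Type*} (X : ℤ → Ω → ℝ) (t : ℤ) : MeasurableSpace Ω :=
  MeasurableSpace.comap (X t) inferInstance

/-- The sigma-algebra `σ(X t, X (t-1), X (t-2), …)` of the whole past up to time `t`. -/
abbrev sigmaPast {Ω : Type*} (X : ℤ → Ω → ℝ) (t : ℤ) : MeasurableSpace Ω :=
  ⨆ (s : ℤ) (_ : s ≤ t), sigmaAt X s

/-- The sigma-algebra `σ(Z (t+1), Z (t+2), …)` of the strict future after time `t`. -/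
abbrev sigmaFuture {Ω : Type*} (Z : ℤ → Ω → ℝ) (t : ℤ) : MeasurableSpace Ω :=
  ⨆ (s : ℤ) (_ : t < s), sigmaAt Z s

/-- `sup_{G ∈ m₁, H ∈ m₂} |P(G ∩ H) - P(G) P(H)|`, as an extended nonnegative real. -/
noncomputable def dependence {Ω : Type*} [MeasurableSpace Ω] (P : Measure Ω)
    (m₁ m₂ : MeasurableSpace Ω) : ℝ≥0∞ :=
  ⨆ (G : Set Ω) (_ : MeasurableSet[m₁] G) (H : Set Ω) (_ : MeasurableSet[m₂] H),
    ENNReal.ofReal |P.real (G ∩ H) - P.real G * P.real H|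

/-- The 2-mixing rate at lag `k`. -/
noncomputable def twoMixingRate {Ω : Type*} [MeasurableSpace Ω] (P : Measure Ω)
    (X : ℤ → Ω → ℝ) (k : ℕ) : ℝ≥0∞ :=
  ⨆ t : ℤ, dependence P (sigmaAt X (t + k)) (sigmaAt X t)

/-- Strict stationarity: all time shifts of the process have the same law on `ℝ^ℤ`. -/
def IsStrictlyStationary {Ω : Type*} [MeasurableSpace Ω] (P : Measure Ω)
    (X : ℤ → Ω → ℝ) : Prop :=
  ∀ h : ℤ, IdentDistrib (fun ω (t : ℤ) => X (t + h) ω) (fun ω (t : ℤ) => X t ω) P P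

/-- `X` is a (squared) ARCH(∞) process with parameters `a 0, a 1, …` and innovations `Z`:
the innovations are i.i.d., positive, of mean one, the parameters are positive, and
`X t = Z t * (a 0 + ∑_{j ≥ 1} a j * X (t - j))` almost surely. The process is nonanticipative:
the innovations after time `t` are independent of the values of `X` up to time `t`. -/
structure IsARCHInfty {Ω : Type*} [MeasurableSpace Ω] (P : Measure Ω)
    (a : ℕ → ℝ) (Z X : ℤ → Ω → ℝ) : Prop where
  measurable_Z : ∀ t, Measurable (Z t)
  measurable_X : ∀ t, Measurable (X t)
  a_pos : ∀ j, 0 < a j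
  Z_indep : iIndepFun Z P
  Z_ident : ∀ t, IdentDistrib (Z t) (Z 0) P P
  Z_pos : ∀ t, ∀ᵐ ω ∂P, 0 < Z t ω
  Z_mean : ∀ t, Integrable (Z t) P ∧ ∫ ω, Z t ω ∂P = 1
  X_nonneg : ∀ t, ∀ᵐ ω ∂P, 0 ≤ X t ω
  representation : ∀ t : ℤ, ∀ᵐ ω ∂P,
    Summable (fun j : ℕ => a (j + 1) * X (t - ((j : ℤ) + 1)) ω) ∧
      X t ω = Z t ω * (a 0 + ∑' j : ℕ, a (j + 1) * X (t - ((j : ℤ) + 1)) ω)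
  nonanticipative : ∀ t : ℤ, Indep (sigmaPast X t) (sigmaFuture Z t) P

/-- `f` is a probability density (with respect to Lebesgue measure) of the variable `Y`. -/
structure IsDensityOf {Ω : Type*} [MeasurableSpace Ω] (P : Measure Ω)
    (Y : Ω → ℝ) (f : ℝ → ℝ) : Prop where
  measurable : Measurable f
  nonneg : ∀ u, 0 ≤ f u
  map_eq : P.map Y = volume.withDensity (fun u => ENNReal.ofReal (f u))

/-- `∫ |f(u) - f(u(1+x))| du ≤ L x` for every `x > 0`. -/
def ScaleLipschitz (f : ℝ → ℝ) (L : ℝ) : Prop :=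
  ∀ x : ℝ, 0 < x → ∫ u, |f u - f (u * (1 + x))| ≤ L * x

/-- `∑_{j ≥ 1} a j < 1 - d` for some `d > 0`, with a convergent series. -/
def SummableBelowOne (a : ℕ → ℝ) : Prop :=
  Summable (fun j : ℕ => a (j + 1)) ∧ ∃ d : ℝ, 0 < d ∧ ∑' j : ℕ, a (j + 1) < 1 - d

/-- The coefficients `ψ j` of the power series `(1 - ∑_{j ≥ 1} a j z^j)⁻¹ = ∑_{j ≥ 0} ψ j z^j`. -/
noncomputable def psi (a : ℕ → ℝ) (j : ℕ) : ℝ :=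
  PowerSeries.coeff j (1 - PowerSeries.mk (fun n => if n = 0 then 0 else a n) : PowerSeries ℝ)⁻¹

/-- `K(ν) = 3 (ν^{1/(1+ν)} + ν^{-ν/(ν+1)})`. -/
noncomputable def constK (ν : ℝ) : ℝ :=
  3 * (ν ^ (1 / (1 + ν)) + ν ^ (-(ν / (ν + 1))))

/-! Write `X (m+1) = Z (m+1) * S`, where the scale `S` is a function of the past. Unrolling the
recursion down to time 0 splits `S = S' + R`: `S'` depends only on `Z 1, …, Z m`, and `R = ∑ T i *
|X (-i)|` with weights `T i` that are also functions of `Z 1, …, Z m`. This is linearity of a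
triangular system in its forcing term (`archScale_eq_volterra`, `volterra_add_tsum`).

For `G = {X (m+1) ∈ B}` the conditional probability given the past is `φ(S)`, with `φ(s) = P(Z s ∈
B)`. Since `φ(S')` is independent of the past up to time 0, the covariance of `G` and `H` is at most
`E|φ(S) - φ(S')|`. The scale-Lipschitz density gives `|φ(S) - φ(S')| ≤ 2 L R / S' ≤ 2 L R / a 0`
(`abs_scaleProb_sub_le`). The difference is also at most 1, hence at most `(2 L R / a 0) ^ p` with
`p = ν/(ν+1) < 1`.

Subadditivity of the power, independence of `T i` from `X (-i)`, and Jensen for each factor finish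
the bound. The mean of `T i` is a convolution of `ψ` with a shift of `a`, because the innovations
have mean one and are independent (`lintegral_volterra`, `volterra_one_eq`).

For the polynomial rate, put `q = δ p`. If `q ≤ 1` the claimed bound is at least 1 and nothing is
needed; if `q > 1` the double sum is estimated termwise (`exists_tsum_convolution_rpow_le`). -/

/-! ### Powers with exponent at most one: subadditivity and Jensen. -/

theorem ENNReal.rpow_sum_le_sum_rpow {ι : Type*} (s : Finset ι) (g : ι → ℝ≥0∞) {p : ℝ}
    (hp : 0 < p) (hp1 : p ≤ 1) : (∑ i ∈ s, g i) ^ p ≤ ∑ i ∈ s, g i ^ p := by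
  classical
  induction s using Finset.induction_on with
  | empty => simp [ENNReal.zero_rpow_of_pos hp]
  | insert i s hi ih =>
    rw [Finset.sum_insert hi, Finset.sum_insert hi]
    exact (ENNReal.rpow_add_le_add_rpow _ _ hp.le hp1).trans (by gcongr)

theorem ENNReal.rpow_tsum_le_tsum_rpow {ι : Type*} (g : ι → ℝ≥0∞) {p : ℝ}
    (hp : 0 < p) (hp1 : p ≤ 1) : (∑' i, g i) ^ p ≤ ∑' i, g i ^ p := by
  rw [← ENNReal.le_rpow_inv_iff hp]
  refine ENNReal.summable.tsum_le_of_sum_le fun s => ?_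
  rw [ENNReal.le_rpow_inv_iff hp]
  exact (ENNReal.rpow_sum_le_sum_rpow s g hp hp1).trans (ENNReal.sum_le_tsum s)

theorem lintegral_rpow_le_rpow_lintegral {Ω : Type*} [MeasurableSpace Ω] (P : Measure Ω)
    [IsProbabilityMeasure P] {g : Ω → ℝ≥0∞} (hg : AEMeasurable g P) {p : ℝ}
    (hp : 0 < p) (hp1 : p < 1) : ∫⁻ ω, g ω ^ p ∂P ≤ (∫⁻ ω, g ω ∂P) ^ p := by
  -- Jensen is Hölder applied to `g ^ p` and the constant 1.
  have hpq : (1 / p).HolderConjugate (1 / (1 - p)) := by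
    rw [Real.holderConjugate_iff]
    exact ⟨by rw [lt_div_iff₀ hp]; linarith, by simp⟩
  have h := ENNReal.lintegral_mul_le_Lp_mul_Lq P hpq (hg.pow_const p)
    (aemeasurable_const (b := (1 : ℝ≥0∞)))
  simpa [← ENNReal.rpow_mul, hp.ne'] using h

/-! ### Lipschitz dependence of the law of `z * s` on the scale `s`. -/

/-- The probability that `z * s` lies in `B` when `z` has law `μ`. -/
noncomputable def scaleProb (μ : Measure ℝ) (B : Set ℝ) (s : ℝ) : ℝ :=
  μ.real ((fun z => z * s) ⁻¹' B)

theorem measurable_scaleProb (μ : Measure ℝ) [IsProbabilityMeasure μ] {B : Set ℝ}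
    (hB : MeasurableSet B) : Measurable (scaleProb μ B) := by
  have h : MeasurableSet ((fun p : ℝ × ℝ => p.2 * p.1) ⁻¹' B) :=
    (measurable_snd.mul measurable_fst) hB
  exact (measurable_measure_prodMk_left h).ennreal_toReal

theorem scaleProb_nonneg (μ : Measure ℝ) (B : Set ℝ) (s : ℝ) : 0 ≤ scaleProb μ B s :=
  measureReal_nonneg

theorem scaleProb_le_one (μ : Measure ℝ) [IsProbabilityMeasure μ] (B : Set ℝ) (s : ℝ) :
    scaleProb μ B s ≤ 1 :=
  measureReal_le_one

section Density

variable {Ω : Type*} [MeasurableSpace Ω] {P : Measure Ω} {Y : Ω → ℝ} {f : ℝ → ℝ} {L : ℝ}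

theorem IsDensityOf.scaleProb_eq (hf : IsDensityOf P Y f) {B : Set ℝ} (hB : MeasurableSet B)
    (s : ℝ) : scaleProb (P.map Y) B s = ∫ u, B.indicator 1 (u * s) * f u := by
  have hm : MeasurableSet ((fun z : ℝ => z * s) ⁻¹' B) := (measurable_id.mul_const s) hB
  rw [scaleProb, hf.map_eq, measureReal_def, withDensity_apply _ hm,
    ← integral_eq_lintegral_of_nonneg_ae (ae_of_all _ hf.nonneg)
      hf.measurable.aestronglyMeasurable, ← integral_indicator hm]
  refine integral_congr_ae (ae_of_all _ fun u => ?_)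
  by_cases h : u * s ∈ B <;> simp [Set.indicator, h]

variable [IsProbabilityMeasure P]

theorem IsDensityOf.lintegral_eq_one (hf : IsDensityOf P Y f) (hY : Measurable Y) :
    ∫⁻ u, ENNReal.ofReal (f u) = 1 := by
  have h := congrArg (fun μ => μ Set.univ) hf.map_eq
  simpa [Measure.map_apply hY] using h.symm

theorem IsDensityOf.integrable (hf : IsDensityOf P Y f) (hY : Measurable Y) : Integrable f := by
  refine ⟨hf.measurable.aestronglyMeasurable, ?_⟩
  rw [hasFiniteIntegral_iff_ofReal (ae_of_all _ hf.nonneg), hf.lintegral_eq_one hY]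
  exact ENNReal.one_lt_top

theorem IsDensityOf.integral_eq_one (hf : IsDensityOf P Y f) (hY : Measurable Y) :
    ∫ u, f u = 1 := by
  rw [integral_eq_lintegral_of_nonneg_ae (ae_of_all _ hf.nonneg)
    hf.measurable.aestronglyMeasurable, hf.lintegral_eq_one hY, ENNReal.toReal_one]

theorem IsDensityOf.integral_comp_mul (hf : IsDensityOf P Y f) (hY : Measurable Y) {x : ℝ}
    (hx : 0 < x) : ∫ u, f (u * (1 + x)) = 1 / (1 + x) := by
  rw [Measure.integral_comp_mul_right f, hf.integral_eq_one hY, abs_of_pos (by positivity)]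
  simp

/-- Dropping the absolute value, the integral of `f u - f (u * (1 + x))` is `x / (1 + x)`, so `1 /
(1 + x) ≤ L`; let `x` tend to 0. -/
theorem IsDensityOf.one_le_of_scaleLipschitz (hf : IsDensityOf P Y f) (hY : Measurable Y)
    (hL : ScaleLipschitz f L) : 1 ≤ L := by
  have key : ∀ x : ℝ, 0 < x → 1 / (1 + x) ≤ L := by
    intro x hx
    have hi := hf.integrable hY
    have hi' : Integrable fun u => f (u * (1 + x)) := hi.comp_mul_right' (by positivity)
    have h1 : ∫ u, (f u - f (u * (1 + x))) ≤ L * x :=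
      (integral_mono (hi.sub hi') (hi.sub hi').abs fun u => le_abs_self _).trans (hL x hx)
    rw [integral_sub hi hi', hf.integral_eq_one hY, hf.integral_comp_mul hY hx] at h1
    have h2 : 1 - 1 / (1 + x) = 1 / (1 + x) * x := by field_simp; ring
    rw [h2] at h1
    exact le_of_mul_le_mul_right h1 hx
  have ht : Tendsto (fun x : ℝ => 1 / (1 + x)) (nhdsWithin 0 (Set.Ioi 0)) (nhds 1) := by
    have : ContinuousAt (fun x : ℝ => 1 / (1 + x)) 0 := by
      apply ContinuousAt.div <;> first | fun_prop | norm_num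
    simpa using (this.tendsto.mono_left nhdsWithin_le_nhds)
  exact le_of_tendsto ht (eventually_nhdsWithin_of_forall fun x hx => key x hx)

/-- One `L * x` is the hypothesis on `f`. The other pays for the Jacobian `1 + x` of the rescaling,
which contributes `x / (1 + x)`; this is at most `L * x` because `1 ≤ L`. -/
theorem IsDensityOf.abs_scaleProb_sub_le (hf : IsDensityOf P Y f) (hY : Measurable Y)
    (hL : ScaleLipschitz f L) {B : Set ℝ} (hB : MeasurableSet B) {s x : ℝ} (hx : 0 ≤ x) :
    |scaleProb (P.map Y) B (s * (1 + x)) - scaleProb (P.map Y) B s| ≤ 2 * L * x := by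
  rcases hx.eq_or_lt with rfl | hx
  · simp
  have hi := hf.integrable hY
  have hi' : Integrable fun u => f (u * (1 + x)) := hi.comp_mul_right' (by positivity)
  have hL1 := hf.one_le_of_scaleLipschitz hY hL
  have hind : ∀ g : ℝ → ℝ, Integrable g →
      Integrable fun u => B.indicator (1 : ℝ → ℝ) (u * (s * (1 + x))) * g u := by
    intro g hg
    refine hg.bdd_mul (c := 1) ?_ (ae_of_all _ fun u => ?_)
    · exact ((measurable_one.indicator hB).comp
        (measurable_id.mul_const (s * (1 + x)))).aestronglyMeasurable
    · by_cases h : u * (s * (1 + x)) ∈ B <;> simp [Set.indicator, h]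
  -- Substituting `u * (1 + x)` for `u` gives both integrals the same indicator, so that only the
  -- densities differ.
  have hsub : scaleProb (P.map Y) B s =
      ∫ u, B.indicator 1 (u * (s * (1 + x))) * ((1 + x) * f (u * (1 + x))) := by
    have h := Measure.integral_comp_mul_right (fun u => B.indicator 1 (u * s) * f u) (1 + x)
    rw [abs_of_pos (by positivity), ← hf.scaleProb_eq hB, smul_eq_mul] at h
    have h' : scaleProb (P.map Y) B s =
        (1 + x) * ∫ u, B.indicator 1 (u * (1 + x) * s) * f (u * (1 + x)) := by
      rw [h]; field_simp
    rw [h', ← integral_const_mul]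
    refine integral_congr_ae (ae_of_all _ fun u => ?_)
    simp only
    rw [show u * (s * (1 + x)) = u * (1 + x) * s by ring]
    ring
  rw [hf.scaleProb_eq hB, hsub, ← integral_sub (hind f hi) (hind _ (hi'.const_mul _))]
  calc |∫ u, (B.indicator 1 (u * (s * (1 + x))) * f u -
          B.indicator 1 (u * (s * (1 + x))) * ((1 + x) * f (u * (1 + x))))|
      ≤ ∫ u, |B.indicator 1 (u * (s * (1 + x))) * f u -
          B.indicator 1 (u * (s * (1 + x))) * ((1 + x) * f (u * (1 + x)))| :=
        abs_integral_le_integral_abs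
    _ ≤ ∫ u, (|f u - f (u * (1 + x))| + x * f (u * (1 + x))) := by
        refine integral_mono ((hind f hi).sub (hind _ (hi'.const_mul _))).abs
          ((hi.sub hi').abs.add (hi'.const_mul x)) fun u => ?_
        have h0 := hf.nonneg (u * (1 + x))
        by_cases h : u * (s * (1 + x)) ∈ B
        · simp only [Set.indicator, h, if_true, Pi.one_apply, one_mul]
          calc |f u - (1 + x) * f (u * (1 + x))|
              = |(f u - f (u * (1 + x))) - x * f (u * (1 + x))| := by ring_nf
            _ ≤ _ := (abs_sub _ _).trans (by rw [abs_of_nonneg (by positivity : 0 ≤ x * f _)])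
        · simp only [Set.indicator, h, if_false, zero_mul, sub_zero, abs_zero]
          positivity
    _ = (∫ u, |f u - f (u * (1 + x))|) + x * (1 / (1 + x)) := by
        have h := integral_add (hi.sub hi').abs (hi'.const_mul x)
        rw [integral_const_mul, hf.integral_comp_mul hY hx] at h
        exact h
    _ ≤ L * x + L * x := by
        have : 1 / (1 + x) ≤ L :=
          (by rw [div_le_one (by positivity)]; linarith : _ ≤ (1 : ℝ)).trans hL1
        refine add_le_add (hL x hx) ?_
        rw [mul_comm]
        exact mul_le_mul_of_nonneg_right this hx.le
    _ = 2 * L * x := by ring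

end Density

/-! ### Triangular Volterra systems. -/

/-- The solution of the triangular system
`V m = b m + ∑_{i < m} A (m - i) * (z i * V i)`. -/
noncomputable def volterra (A b z : ℕ → ℝ≥0∞) : ℕ → ℝ≥0∞
  | m => b m + ∑ i : Fin m, A (m - i) * (z i * volterra A b z i)

theorem volterra_eq (A b z : ℕ → ℝ≥0∞) (m : ℕ) :
    volterra A b z m = b m + ∑ i ∈ Finset.range m, A (m - i) * (z i * volterra A b z i) := by
  rw [volterra, Finset.sum_range]

theorem eq_volterra {A b z V : ℕ → ℝ≥0∞} {n : ℕ}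
    (hV : ∀ m ≤ n, V m = b m + ∑ i ∈ Finset.range m, A (m - i) * (z i * V i)) :
    V n = volterra A b z n := by
  induction n using Nat.strong_induction_on with
  | _ n ih =>
    rw [hV n le_rfl, volterra_eq]
    congr 1
    refine Finset.sum_congr rfl fun i hi => ?_
    have hi := Finset.mem_range.1 hi
    rw [ih i hi fun m hm => hV m (hm.trans hi.le)]

/-- The system is linear in its forcing term, so superposed solutions solve the superposed system,
and `eq_volterra` gives uniqueness. -/
theorem volterra_add_tsum (A b z : ℕ → ℝ≥0∞) (c : ℕ → ℕ → ℝ≥0∞) (y : ℕ → ℝ≥0∞) (n : ℕ) :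
    volterra A (fun m => b m + ∑' i, c i m * y i) z n =
      volterra A b z n + ∑' i, volterra A (c i) z n * y i := by
  symm
  refine eq_volterra (V := fun n => volterra A b z n + ∑' i, volterra A (c i) z n * y i)
    fun m _ => ?_
  have h : ∑ j ∈ Finset.range m, A (m - j) * (z j * (∑' i, volterra A (c i) z j * y i)) =
      ∑' i, ∑ j ∈ Finset.range m, A (m - j) * (z j * (volterra A (c i) z j * y i)) := by
    rw [Summable.tsum_finsetSum fun _ _ => ENNReal.summable]
    simp_rw [ENNReal.tsum_mul_left]
  simp only [mul_add, Finset.sum_add_distrib]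
  rw [h, volterra_eq A b z m, tsum_congr fun i => by rw [volterra_eq A (c i) z m]]
  simp only [add_mul, ENNReal.tsum_add, Finset.sum_mul, mul_assoc]
  abel

theorem le_volterra (A b z : ℕ → ℝ≥0∞) (m : ℕ) : b m ≤ volterra A b z m := by
  rw [volterra_eq]; exact le_self_add

theorem measurable_volterra {Ω : Type*} {m : MeasurableSpace Ω} (A b : ℕ → ℝ≥0∞)
    {z : ℕ → Ω → ℝ≥0∞} {n : ℕ} (hz : ∀ i < n, Measurable (z i)) :
    Measurable fun ω => volterra A b (fun i => z i ω) n := by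
  induction n using Nat.strong_induction_on with
  | _ n ih =>
    simp_rw [fun ω => volterra_eq A b (fun i => z i ω) n]
    refine measurable_const.add (Finset.measurable_fun_sum _ fun i hi => ?_)
    have hi := Finset.mem_range.1 hi
    exact ((hz i hi).mul (ih i hi fun j hj => hz j (hj.trans hi))).const_mul _

/-! ### The power series `ψ` as resolvent of the coefficients `a`. -/

section Psi

open PowerSeries

variable {a : ℕ → ℝ}

theorem mk_psi (a : ℕ → ℝ) :
    (PowerSeries.mk (psi a) : PowerSeries ℝ) =
      1 + PowerSeries.mk (fun n => if n = 0 then 0 else a n) * PowerSeries.mk (psi a) := by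
  have h : (PowerSeries.mk (psi a) : PowerSeries ℝ) =
      (1 - PowerSeries.mk (fun n => if n = 0 then 0 else a n) : PowerSeries ℝ)⁻¹ := by
    ext n; simp [psi]
  have h1 : (1 - PowerSeries.mk (fun n => if n = 0 then 0 else a n) : PowerSeries ℝ) *
      PowerSeries.mk (psi a) = 1 := by
    rw [h]
    exact PowerSeries.mul_inv_cancel _ (by simp)
  linear_combination h1

theorem coeff_mk_shift_mul (a : ℕ → ℝ) (q : PowerSeries ℝ) (n : ℕ) :
    coeff n (PowerSeries.mk (fun n => if n = 0 then 0 else a n) * q) =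
      ∑ i ∈ Finset.range n, a (n - i) * coeff i q := by
  rw [mul_comm, PowerSeries.coeff_mul, Finset.Nat.sum_antidiagonal_eq_sum_range_succ
    (fun i j => coeff i q * coeff j (PowerSeries.mk (fun n => if n = 0 then 0 else a n))),
    -- The last term vanishes: the series of the `a j` has no constant coefficient.
    Finset.sum_range_succ]
  simp only [coeff_mk, Nat.sub_self, if_true, mul_zero, add_zero]
  refine Finset.sum_congr rfl fun i hi => ?_
  have := Finset.mem_range.1 hi
  rw [if_neg (by omega), mul_comm]

theorem psi_nonneg (ha : ∀ j, 0 ≤ a j) (n : ℕ) : 0 ≤ psi a n := by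
  induction n using Nat.strong_induction_on with
  | _ n ih =>
    have h := congrArg (coeff n) (mk_psi a)
    rw [map_add, coeff_mk_shift_mul, coeff_mk] at h
    rw [h, coeff_one]
    refine add_nonneg (by split_ifs <;> norm_num) (Finset.sum_nonneg fun i hi => ?_)
    rw [coeff_mk]
    exact mul_nonneg (ha _) (ih i (Finset.mem_range.1 hi))

/-- With unit multipliers the system reads `V = b + a * V` for convolution. The product of `ψ` and
`b` solves it since `ψ = 1 + a * ψ`, and the absolute values are harmless as `ψ` is nonnegative. -/
theorem volterra_one_eq (ha : ∀ j, 0 ≤ a j) {b : ℕ → ℝ} (hb : ∀ j, 0 ≤ b j) (n : ℕ) :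
    volterra (fun j => ENNReal.ofReal (a j)) (fun j => ENNReal.ofReal (b j)) (fun _ => 1) n =
      ENNReal.ofReal (∑ j ∈ Finset.range (n + 1), |psi a j| * b (n - j)) := by
  symm
  have hnn : ∀ m, 0 ≤ ∑ j ∈ Finset.range (m + 1), |psi a j| * b (m - j) := fun m =>
    Finset.sum_nonneg fun i _ => mul_nonneg (abs_nonneg _) (hb _)
  refine eq_volterra
    (V := fun n => ENNReal.ofReal (∑ j ∈ Finset.range (n + 1), |psi a j| * b (n - j)))
    fun m _ => ?_
  have hc : ∀ m, ∑ j ∈ Finset.range (m + 1), |psi a j| * b (m - j) =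
      coeff m (PowerSeries.mk (psi a) * PowerSeries.mk b) := by
    intro m
    rw [PowerSeries.coeff_mul, Finset.Nat.sum_antidiagonal_eq_sum_range_succ
      (fun i j => coeff i (PowerSeries.mk (psi a)) * coeff j (PowerSeries.mk b))]
    simp [abs_of_nonneg (psi_nonneg ha _)]
  have hr : ∑ j ∈ Finset.range (m + 1), |psi a j| * b (m - j) = b m +
      ∑ i ∈ Finset.range m, a (m - i) * ∑ j ∈ Finset.range (i + 1), |psi a j| * b (i - j) := by
    simp_rw [hc]
    conv_lhs => rw [mk_psi a, add_mul, one_mul, mul_assoc, map_add, coeff_mk_shift_mul, coeff_mk]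
  simp only [one_mul]
  rw [hr, ENNReal.ofReal_add (hb m) (Finset.sum_nonneg fun i _ => mul_nonneg (ha _) (hnn i)),
    ENNReal.ofReal_sum_of_nonneg fun i _ => mul_nonneg (ha _) (hnn i)]
  congr 1
  exact Finset.sum_congr rfl fun i _ => ENNReal.ofReal_mul (ha _)

end Psi

/-! ### Conditioning on the past and the covariance bound. -/

theorem measureReal_preimage_mul_inter {Ω : Type*} {m m₀ : MeasurableSpace Ω} {P : Measure Ω}
    [IsProbabilityMeasure P] (hm : m ≤ m₀) {z s : Ω → ℝ}
    (hz : Measurable z) (hs : Measurable[m] s) {H : Set Ω} (hH : MeasurableSet[m] H)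
    (hind : Indep m (MeasurableSpace.comap z inferInstance) P) {B : Set ℝ}
    (hB : MeasurableSet B) :
    P.real ((fun ω => z ω * s ω) ⁻¹' B ∩ H) = ∫ ω in H, scaleProb (P.map z) B (s ω) ∂P := by
  -- Membership in `H` is carried as a `Prop`-valued coordinate, so that one product law handles `s`
  -- and `H` together and Fubini applies.
  have hY : Measurable[m] fun ω => (s ω, ω ∈ H) :=
    (fun (_ : MeasurableSpace Ω) (hs : Measurable s) (hH : MeasurableSet H) =>
      hs.prodMk (measurable_mem.2 hH)) m hs hH
  have hY' : Measurable fun ω => (s ω, ω ∈ H) := hY.mono hm le_rfl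
  have hi : IndepFun (fun ω => (s ω, ω ∈ H)) z P :=
    (IndepFun_iff_Indep _ _ _).2 (indep_of_indep_of_le_left hind hY.comap_le)
  have hmap := (indepFun_iff_map_prod_eq_prod_map_map hY'.aemeasurable hz.aemeasurable).1 hi
  have hzP : IsProbabilityMeasure (P.map z) := Measure.isProbabilityMeasure_map hz.aemeasurable
  let C : Set ((ℝ × Prop) × ℝ) := {p | p.2 * p.1.1 ∈ B ∧ p.1.2}
  have hC : MeasurableSet C :=
    ((measurable_snd.mul measurable_fst.fst) hB).inter
      (measurableSet_setOfPred.2 measurable_fst.snd)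
  have h1 : P ((fun ω => z ω * s ω) ⁻¹' B ∩ H) =
      ∫⁻ ω in H, P.map z ((fun u => u * s ω) ⁻¹' B) ∂P := by
    have h2 := congrArg (fun μ => μ C) hmap
    rw [Measure.map_apply (hY'.prodMk hz) hC, Measure.prod_apply hC,
      lintegral_map (measurable_measure_prodMk_left hC) hY'] at h2
    rw [← lintegral_indicator (hm _ hH)]
    refine (h2.trans (lintegral_congr fun ω => ?_) :)
    by_cases h : ω ∈ H
    · simp only [Set.indicator, h, if_true]
      congr 1
      ext u
      simp [C]
    · simp [Set.indicator, h, C]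
  have hms : Measurable fun ω => scaleProb (P.map z) B (s ω) :=
    (measurable_scaleProb _ hB).comp (hs.mono hm le_rfl)
  rw [measureReal_def, h1, integral_eq_lintegral_of_nonneg_ae
    (ae_of_all _ fun ω => scaleProb_nonneg _ _ _) hms.aestronglyMeasurable]
  congr 1
  refine lintegral_congr fun ω => ?_
  rw [scaleProb, ofReal_measureReal]

/-- As `g'` has zero covariance with the indicator of `H`, the covariance of `g` is the integral of
`(1_H - P H) * (g - g')`, whose first factor is at most 1 in modulus. -/
theorem ofReal_abs_covariance_le {Ω : Type*} {m₀ : MeasurableSpace Ω} {P : Measure Ω}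
    [IsProbabilityMeasure P] {g g' : Ω → ℝ} (hg : Integrable g P) (hg' : Integrable g' P)
    {H : Set Ω} (hH : MeasurableSet H) (hind : ∫ ω in H, g' ω ∂P = P.real H * ∫ ω, g' ω ∂P) :
    ENNReal.ofReal |(∫ ω in H, g ω ∂P) - (∫ ω, g ω ∂P) * P.real H| ≤
      ∫⁻ ω, ENNReal.ofReal |g ω - g' ω| ∂P := by
  have hd : Integrable (fun ω => g ω - g' ω) P := hg.sub hg'
  have h1 : (∫ ω in H, g ω ∂P) - (∫ ω, g ω ∂P) * P.real H =
      ∫ ω, (H.indicator (fun ω => g ω - g' ω) ω - P.real H * (g ω - g' ω)) ∂P := by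
    rw [integral_sub (hd.indicator hH) (hd.const_mul _), integral_indicator hH,
      integral_const_mul, integral_sub hg.integrableOn hg'.integrableOn, integral_sub hg hg',
      hind]
    ring
  rw [h1, ← ofReal_integral_eq_lintegral_ofReal hd.abs (ae_of_all _ fun _ => abs_nonneg _)]
  refine ENNReal.ofReal_le_ofReal (abs_integral_le_integral_abs.trans ?_)
  refine integral_mono ((hd.indicator hH).sub (hd.const_mul _)).abs hd.abs fun ω => ?_
  have hp0 : 0 ≤ P.real H := measureReal_nonneg
  have hp1 : P.real H ≤ 1 := measureReal_le_one
  simp only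
  by_cases h : ω ∈ H
  · rw [Set.indicator_of_mem h, ← one_sub_mul, abs_mul, abs_of_nonneg (by linarith)]
    exact mul_le_of_le_one_left (abs_nonneg _) (by linarith)
  · rw [Set.indicator_of_notMem h, zero_sub, abs_neg, abs_mul, abs_of_nonneg hp0]
    exact mul_le_of_le_one_left (abs_nonneg _) hp1

/-! ### The ARCH recursion and its dependence bound. -/

/-- The conditional scale `a 0 + ∑_{j ≥ 1} a j * |X (t - j)|` of an ARCH(∞) process. -/
noncomputable def archScale {Ω : Type*} (a : ℕ → ℝ) (X : ℤ → Ω → ℝ) (t : ℤ) (ω : Ω) : ℝ≥0∞ :=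
  ENNReal.ofReal (a 0) + ∑' j : ℕ, ENNReal.ofReal (a (j + 1)) * ‖X (t - ((j : ℤ) + 1)) ω‖ₑ

section ARCH

variable {Ω : Type*} {m₀ : MeasurableSpace Ω} {P : Measure Ω} {a : ℕ → ℝ} {Z X : ℤ → Ω → ℝ}

theorem sigmaAt_le_sigmaPast (X : ℤ → Ω → ℝ) {s t : ℤ} (h : s ≤ t) :
    sigmaAt X s ≤ sigmaPast X t :=
  le_iSup₂_of_le s h le_rfl

theorem sigmaAt_le_sigmaFuture (Z : ℤ → Ω → ℝ) {s t : ℤ} (h : t < s) :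
    sigmaAt Z s ≤ sigmaFuture Z t :=
  le_iSup₂_of_le s h le_rfl

theorem measurable_sigmaPast (X : ℤ → Ω → ℝ) {s t : ℤ} (h : s ≤ t) :
    Measurable[sigmaPast X t] (X s) :=
  (comap_measurable (X s)).mono (sigmaAt_le_sigmaPast X h) le_rfl

theorem measurable_sigmaFuture (Z : ℤ → Ω → ℝ) {s t : ℤ} (h : t < s) :
    Measurable[sigmaFuture Z t] (Z s) :=
  (comap_measurable (Z s)).mono (sigmaAt_le_sigmaFuture Z h) le_rfl

theorem measurable_archScale (a : ℕ → ℝ) (X : ℤ → Ω → ℝ) {s t : ℤ} (h : t ≤ s + 1) :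
    Measurable[sigmaPast X s] (archScale a X t) := by
  let _ : MeasurableSpace Ω := sigmaPast X s
  refine Measurable.const_add (Measurable.tsum fun j => ?_) _
  exact ((measurable_sigmaPast X (by omega)).enorm).const_mul _

namespace IsARCHInfty

theorem sigmaPast_le (hX : IsARCHInfty P a Z X) (t : ℤ) : sigmaPast X t ≤ m₀ :=
  iSup₂_le fun s _ => (hX.measurable_X s).comap_le

theorem sigmaFuture_le (hX : IsARCHInfty P a Z X) (t : ℤ) : sigmaFuture Z t ≤ m₀ :=
  iSup₂_le fun s _ => (hX.measurable_Z s).comap_le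

theorem archScale_ae (hX : IsARCHInfty P a Z X) (t : ℤ) :
    ∀ᵐ ω ∂P, archScale a X t ω ≠ ∞ ∧ X t ω = Z t ω * (archScale a X t ω).toReal ∧
      ‖X t ω‖ₑ = ‖Z t ω‖ₑ * archScale a X t ω := by
  filter_upwards [hX.representation t, ae_all_iff.2 hX.X_nonneg] with ω ⟨hs, hx⟩ hnn
  have hnn' : ∀ j : ℕ, 0 ≤ a (j + 1) * X (t - ((j : ℤ) + 1)) ω := fun j =>
    mul_nonneg (hX.a_pos _).le (hnn _)
  have heq : archScale a X t ω =
      ENNReal.ofReal (a 0 + ∑' j : ℕ, a (j + 1) * X (t - ((j : ℤ) + 1)) ω) := by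
    rw [archScale, ENNReal.ofReal_add (hX.a_pos 0).le (tsum_nonneg hnn'),
      ENNReal.ofReal_tsum_of_nonneg hnn' hs]
    congr 1
    refine tsum_congr fun j => ?_
    rw [ENNReal.ofReal_mul (hX.a_pos _).le, Real.enorm_of_nonneg (hnn _)]
  have hpos : 0 ≤ a 0 + ∑' j : ℕ, a (j + 1) * X (t - ((j : ℤ) + 1)) ω :=
    add_nonneg (hX.a_pos 0).le (tsum_nonneg hnn')
  refine ⟨heq ▸ ENNReal.ofReal_ne_top, ?_, ?_⟩
  · rw [heq, ENNReal.toReal_ofReal hpos, hx]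
  · rw [heq, ← Real.enorm_of_nonneg hpos, ← enorm_mul, ← hx]

/-- The terms of the scale at time `m + 1` are split at time 0. Times `1, …, m` form the triangular
part, where `Z (i+1)` times the scale at `i + 1` is `X (i+1)`; times `0, -1, …` enter the forcing.
-/
theorem archScale_eq_volterra (hX : IsARCHInfty P a Z X) (m : ℕ) :
    ∀ᵐ ω ∂P, archScale a X (m + 1) ω =
      volterra (fun j => ENNReal.ofReal (a j))
        (fun m => ENNReal.ofReal (a 0) +
          ∑' i : ℕ, ENNReal.ofReal (a (m + 1 + i)) * ‖X (-(i : ℤ)) ω‖ₑ)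
        (fun i => ‖Z (i + 1) ω‖ₑ) m := by
  filter_upwards [ae_all_iff.2 hX.archScale_ae] with ω hω
  refine eq_volterra (V := fun m : ℕ => archScale a X (m + 1) ω) fun n _ => ?_
  have hx : ∀ i : ℕ, ‖Z (i + 1) ω‖ₑ * archScale a X (i + 1) ω = ‖X (i + 1) ω‖ₑ := fun i =>
    (hω _).2.2.symm
  simp only [hx]
  rw [archScale, ← ENNReal.summable.sum_add_tsum_nat_add' (k := n), add_assoc,
    add_comm (∑ i ∈ Finset.range n, _)]
  congr 2
  · refine tsum_congr fun i => ?_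
    rw [show i + n + 1 = n + 1 + i by ring]
    congr 4
    push_cast
    ring
  · rw [← Finset.sum_range_reflect]
    refine Finset.sum_congr rfl fun i hi => ?_
    have hi := Finset.mem_range.1 hi
    rw [show n - 1 - i + 1 = n - i by omega]
    congr 4
    omega

theorem indep_innovations (hX : IsARCHInfty P a Z X) (t : ℤ) :
    Indep (sigmaPast Z t) (sigmaFuture Z t) P :=
  indep_iSup_of_disjoint (fun s => (hX.measurable_Z s).comap_le)
    ((iIndepFun_iff_iIndep _ _ _).1 hX.Z_indep) (S := {s | s ≤ t}) (T := {s | t < s})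
    (Set.disjoint_left.2 fun s (hs : s ≤ t) (hs' : t < s) => absurd hs hs'.not_ge)

theorem lintegral_enorm_innovation (hX : IsARCHInfty P a Z X) (t : ℤ) :
    ∫⁻ ω, ‖Z t ω‖ₑ ∂P = 1 := by
  have h0 : 0 ≤ᵐ[P] Z t := (hX.Z_pos t).mono fun ω h => h.le
  have h : ∫⁻ ω, ‖Z t ω‖ₑ ∂P = ∫⁻ ω, ENNReal.ofReal (Z t ω) ∂P :=
    lintegral_congr_ae (h0.mono fun ω h => Real.enorm_of_nonneg h)
  rw [h, ← ofReal_integral_eq_lintegral_ofReal (hX.Z_mean t).1 h0, (hX.Z_mean t).2,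
    ENNReal.ofReal_one]

/-- The solution at index `i` involves only `Z 1, …, Z i`, so it is independent of its multiplier `Z
(i+1)`, which has mean one. -/
theorem lintegral_volterra (hX : IsARCHInfty P a Z X) (A b : ℕ → ℝ≥0∞) (n : ℕ) :
    ∫⁻ ω, volterra A b (fun i => ‖Z (i + 1) ω‖ₑ) n ∂P = volterra A b (fun _ => 1) n := by
  induction n using Nat.strong_induction_on with
  | _ n ih =>
    have := hX.Z_indep.isProbabilityMeasure
    have hz : ∀ i : ℕ, Measurable fun ω => ‖Z (i + 1) ω‖ₑ := fun i => (hX.measurable_Z _).enorm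
    have hm : ∀ i, Measurable fun ω => volterra A b (fun i => ‖Z (i + 1) ω‖ₑ) i := fun i =>
      measurable_volterra (z := fun i ω => ‖Z (i + 1) ω‖ₑ) A b fun j _ => hz j
    simp_rw [volterra_eq A b _ n]
    rw [lintegral_add_left measurable_const, lintegral_const, measure_univ, mul_one,
      lintegral_finsetSum _ fun i _ => by fun_prop]
    congr 1
    refine Finset.sum_congr rfl fun i hi => ?_
    rw [lintegral_const_mul _ (by fun_prop), ← ih i (Finset.mem_range.1 hi)]
    congr 1
    have hf : Measurable[sigmaFuture Z i] fun ω => ‖Z (i + 1) ω‖ₑ :=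
      measurable_enorm.comp (measurable_sigmaFuture Z (by omega))
    have hg : Measurable[sigmaPast Z i] fun ω => volterra A b (fun i => ‖Z (i + 1) ω‖ₑ) i :=
      measurable_volterra (m := sigmaPast Z i) (z := fun i ω => ‖Z (i + 1) ω‖ₑ) A b
        fun j hj => measurable_enorm.comp (measurable_sigmaPast Z (by omega))
    rw [lintegral_mul_eq_lintegral_mul_lintegral_of_independent_measurableSpace
      (hX.sigmaFuture_le i) (iSup₂_le fun s _ => (hX.measurable_Z s).comap_le)
      (hX.indep_innovations i).symm hf hg, hX.lintegral_enorm_innovation]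

theorem map_innovation (hX : IsARCHInfty P a Z X) (t : ℤ) : P.map (Z t) = P.map (Z 0) :=
  (hX.Z_ident t).map_eq

theorem dependence_le_tsum [IsProbabilityMeasure P] (hX : IsARCHInfty P a Z X) {f : ℝ → ℝ}
    {L : ℝ} (hf : IsDensityOf P (Z 0) f) (hL : ScaleLipschitz f L) {p : ℝ} (hp : 0 < p)
    (hp1 : p ≤ 1) (m : ℕ) :
    dependence P (sigmaAt X (m + 1)) (sigmaPast X 0) ≤
      ENNReal.ofReal (2 * L / a 0) ^ p * ∑' i : ℕ,
        (∫⁻ ω, volterra (fun j => ENNReal.ofReal (a j)) (fun m => ENNReal.ofReal (a (m + 1 + i)))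
          (fun i => ‖Z (i + 1) ω‖ₑ) m ^ p ∂P) * ∫⁻ ω, ‖X (-(i : ℤ)) ω‖ₑ ^ p ∂P := by
  have hL1 := hf.one_le_of_scaleLipschitz (hX.measurable_Z 0) hL
  have ha0 := hX.a_pos 0
  set A : ℕ → ℝ≥0∞ := fun j => ENNReal.ofReal (a j) with hA
  set T : ℕ → Ω → ℝ≥0∞ := fun i ω =>
    volterra A (fun m => ENNReal.ofReal (a (m + 1 + i))) (fun i => ‖Z (i + 1) ω‖ₑ) m with hT
  set S' : Ω → ℝ≥0∞ := fun ω =>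
    volterra A (fun _ => ENNReal.ofReal (a 0)) (fun i => ‖Z (i + 1) ω‖ₑ) m with hS'
  set S : Ω → ℝ≥0∞ := archScale a X (m + 1) with hS
  have hmF : ∀ b, Measurable[sigmaFuture Z 0] fun ω =>
      volterra A b (fun i => ‖Z (i + 1) ω‖ₑ) m := fun b =>
    measurable_volterra (m := sigmaFuture Z 0) (z := fun i ω => ‖Z (i + 1) ω‖ₑ) A b
      fun i _ => measurable_enorm.comp (measurable_sigmaFuture Z (by omega))
  have hmS : Measurable[sigmaPast X m] fun ω => (S ω).toReal :=
    ENNReal.measurable_toReal.comp (measurable_archScale a X le_rfl)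
  have hmS' : Measurable[sigmaFuture Z 0] fun ω => (S' ω).toReal :=
    ENNReal.measurable_toReal.comp (hmF _)
  have hdecomp : ∀ᵐ ω ∂P, S ω = S' ω + ∑' i : ℕ, T i ω * ‖X (-(i : ℤ)) ω‖ₑ := by
    filter_upwards [hX.archScale_eq_volterra m] with ω hω
    rw [hS, hω]
    exact volterra_add_tsum A _ _ (fun i m => ENNReal.ofReal (a (m + 1 + i))) _ m
  have hμ : IsProbabilityMeasure (P.map (Z 0)) :=
    Measure.isProbabilityMeasure_map (hX.measurable_Z 0).aemeasurable
  have hrhs : ENNReal.ofReal (2 * L / a 0) ^ p * ∑' i : ℕ,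
        (∫⁻ ω, T i ω ^ p ∂P) * ∫⁻ ω, ‖X (-(i : ℤ)) ω‖ₑ ^ p ∂P =
      ∫⁻ ω, ENNReal.ofReal (2 * L / a 0) ^ p * ∑' i : ℕ, (T i ω * ‖X (-(i : ℤ)) ω‖ₑ) ^ p ∂P := by
    have hTm : ∀ i, Measurable (T i) := fun i => (hmF _).mono (hX.sigmaFuture_le 0) le_rfl
    rw [lintegral_const_mul, lintegral_tsum]
    · congr 1
      refine tsum_congr fun i => ?_
      simp_rw [ENNReal.mul_rpow_of_nonneg _ _ hp.le]
      exact (lintegral_mul_eq_lintegral_mul_lintegral_of_independent_measurableSpace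
        (hX.sigmaFuture_le 0) (hX.sigmaPast_le 0) (hX.nonanticipative 0).symm
        ((measurable_id.pow_const p).comp (hmF _))
        (((measurable_id.pow_const p).comp measurable_enorm).comp
          (measurable_sigmaPast X (by omega)))).symm
    · exact fun i => (((hTm i).mul (hX.measurable_X _).enorm).pow_const p).aemeasurable
    · exact Measurable.tsum fun i => ((hTm i).mul (hX.measurable_X _).enorm).pow_const p
  refine iSup₂_le fun G hG => iSup₂_le fun H hH => ?_
  obtain ⟨B, hB, rfl⟩ := hG
  have hH₀ : MeasurableSet[m₀] H := hX.sigmaPast_le 0 _ hH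
  have hHm : MeasurableSet[sigmaPast X m] H :=
    (iSup₂_le fun s hs => sigmaAt_le_sigmaPast X (by omega) :
      sigmaPast X 0 ≤ sigmaPast X m) _ hH
  have hindep : Indep (sigmaPast X m) (sigmaAt Z (m + 1)) P :=
    indep_of_indep_of_le_right (hX.nonanticipative m) (sigmaAt_le_sigmaFuture Z (by omega))
  have hφ := measurable_scaleProb (P.map (Z 0)) hB
  have hint : ∀ s : Ω → ℝ, Measurable s →
      Integrable (fun ω => scaleProb (P.map (Z 0)) B (s ω)) P := fun s hs =>
    Integrable.of_bound (hφ.comp hs).aestronglyMeasurable 1 (ae_of_all _ fun ω => by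
      rw [Real.norm_of_nonneg (scaleProb_nonneg _ _ _)]; exact scaleProb_le_one _ _ _)
  have hjoint : ∀ H, MeasurableSet[sigmaPast X m] H → P.real (X (m + 1) ⁻¹' B ∩ H) =
      ∫ ω in H, scaleProb (P.map (Z 0)) B (S ω).toReal ∂P := by
    intro H hH
    rw [← hX.map_innovation (m + 1), ← measureReal_preimage_mul_inter (hX.sigmaPast_le m)
      (hX.measurable_Z _) hmS hH hindep hB]
    refine measureReal_congr ?_
    refine EventuallyEq.inter ?_ EventuallyEq.rfl
    filter_upwards [hX.archScale_ae (m + 1)] with ω hω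
    simp only [Set.preimage, eq_iff_iff, hS]
    exact congrArg (· ∈ B) hω.2.1 |>.to_iff
  have hG1 : P.real (X (m + 1) ⁻¹' B) = ∫ ω, scaleProb (P.map (Z 0)) B (S ω).toReal ∂P := by
    simpa using hjoint Set.univ MeasurableSet.univ
  rw [hjoint H hHm, hG1]
  refine (ofReal_abs_covariance_le (hint _ (hmS.mono (hX.sigmaPast_le m) le_rfl))
    (hint _ (hmS'.mono (hX.sigmaFuture_le 0) le_rfl)) hH₀ ?_).trans ?_
  · exact Indep.setIntegral_eq_mul (hX.sigmaPast_le 0)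
      (indep_of_indep_of_le_right (hX.nonanticipative 0) hmS'.comap_le)
      (hmS'.mono (hX.sigmaFuture_le 0) le_rfl).aemeasurable hH hφ.aestronglyMeasurable
  · rw [hrhs]
    refine lintegral_mono_ae ?_
    filter_upwards [hdecomp, hX.archScale_ae (m + 1)] with ω hω hω'
    set R := ∑' i : ℕ, T i ω * ‖X (-(i : ℤ)) ω‖ₑ with hR
    have hfin : S' ω + R ≠ ∞ := hω ▸ hω'.1
    obtain ⟨hS't, hRt⟩ := ENNReal.add_ne_top.1 hfin
    -- The forcing `a 0` alone bounds `S'` below, which turns the relative increment `R / S'` into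
    -- `R / a 0`.
    have hS'0 : a 0 ≤ (S' ω).toReal := by
      rw [← ENNReal.ofReal_le_iff_le_toReal hS't]
      exact le_volterra A _ _ m
    have hS'pos : 0 < (S' ω).toReal := ha0.trans_le hS'0
    set d := |scaleProb (P.map (Z 0)) B (S ω).toReal - scaleProb (P.map (Z 0)) B (S' ω).toReal|
      with hd
    have hd1 : d ≤ 1 := abs_sub_le_of_nonneg_of_le (scaleProb_nonneg _ _ _)
      (scaleProb_le_one _ _ _) (scaleProb_nonneg _ _ _) (scaleProb_le_one _ _ _)
    have hdR : d ≤ 2 * L / a 0 * R.toReal := by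
      have h := hf.abs_scaleProb_sub_le (hX.measurable_Z 0) hL hB (s := (S' ω).toReal)
        (x := R.toReal / (S' ω).toReal) (by positivity)
      rw [mul_add, mul_one, mul_div_cancel₀ _ hS'pos.ne', ← ENNReal.toReal_add hS't hRt, ← hω] at h
      refine h.trans ?_
      rw [div_mul_eq_mul_div, mul_div_assoc]
      gcongr
    -- A number in `[0, 1]` only grows when raised to a power `p ≤ 1`.
    calc ENNReal.ofReal d ≤ ENNReal.ofReal d ^ p := by
          conv_lhs => rw [← ENNReal.rpow_one (ENNReal.ofReal d)]
          exact ENNReal.rpow_le_rpow_of_exponent_ge (ENNReal.ofReal_le_one.2 hd1) hp1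
      _ ≤ (ENNReal.ofReal (2 * L / a 0) * R) ^ p := by
          gcongr
          refine (ENNReal.ofReal_le_ofReal hdR).trans ?_
          rw [ENNReal.ofReal_mul (by positivity), ENNReal.ofReal_toReal hRt]
      _ ≤ _ := by
          rw [ENNReal.mul_rpow_of_nonneg _ _ hp.le]
          gcongr
          exact ENNReal.rpow_tsum_le_tsum_rpow _ hp hp1

end IsARCHInfty

end ARCH

/-! ### Trivial bounds and consequences of stationarity. -/

theorem three_le_constK {ν : ℝ} (hν : 1 < ν) : 3 ≤ constK ν := by
  have h1 : 1 ≤ ν ^ (1 / (1 + ν)) := Real.one_le_rpow hν.le (by positivity)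
  have h2 : 0 ≤ ν ^ (-(ν / (ν + 1))) := by positivity
  rw [constK]
  linarith

theorem dependence_le_one {Ω : Type*} (m₁ m₂ : MeasurableSpace Ω) [MeasurableSpace Ω]
    (P : Measure Ω) [IsProbabilityMeasure P] :
    dependence P m₁ m₂ ≤ 1 := by
  refine iSup₂_le fun G hG => iSup₂_le fun H hH => ENNReal.ofReal_le_one.2 ?_
  exact abs_sub_le_of_nonneg_of_le measureReal_nonneg measureReal_le_one
    (mul_nonneg measureReal_nonneg measureReal_nonneg)
    (mul_le_one₀ measureReal_le_one measureReal_nonneg measureReal_le_one)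

section Stationary

variable {Ω : Type*} [MeasurableSpace Ω] {P : Measure Ω} {X : ℤ → Ω → ℝ}

theorem IsStrictlyStationary.identDistrib (h : IsStrictlyStationary P X) (t : ℤ) :
    IdentDistrib (X t) (X 0) P P := by
  simpa [Function.comp_def] using (h t).comp (measurable_pi_apply (0 : ℤ))

theorem IsStrictlyStationary.dependence_shift (h : IsStrictlyStationary P X) (s t : ℤ) :
    dependence P (sigmaAt X (t + s)) (sigmaAt X t) ≤ dependence P (sigmaAt X s) (sigmaAt X 0) := by
  refine iSup₂_le fun G hG => iSup₂_le fun H hH => ?_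
  obtain ⟨B, hB, rfl⟩ := hG
  obtain ⟨C, hC, rfl⟩ := hH
  have hpre : ∀ D : Set (ℤ → ℝ), MeasurableSet D →
      P.real ((fun ω (r : ℤ) => X (r + t) ω) ⁻¹' D) = P.real ((fun ω (r : ℤ) => X r ω) ⁻¹' D) :=
    fun D hD => by rw [measureReal_def, measureReal_def, (h t).measure_mem_eq hD]
  have hB' : MeasurableSet ((fun x : ℤ → ℝ => x s) ⁻¹' B) := measurable_pi_apply s hB
  have hC' : MeasurableSet ((fun x : ℤ → ℝ => x 0) ⁻¹' C) := measurable_pi_apply 0 hC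
  have h1 := hpre _ hB'
  have h2 := hpre _ hC'
  have h3 := hpre _ (hB'.inter hC')
  simp only [Set.preimage_inter, ← Set.preimage_comp, Function.comp_def, zero_add] at h1 h2 h3
  rw [add_comm s t] at h1 h3
  rw [h1, h2, h3]
  exact le_iSup₂_of_le _ ⟨B, hB, rfl⟩ (le_iSup₂_of_le _ ⟨C, hC, rfl⟩ le_rfl)

theorem IsStrictlyStationary.twoMixingRate_le (h : IsStrictlyStationary P X) (k : ℕ) :
    twoMixingRate P X k ≤ dependence P (sigmaAt X k) (sigmaPast X 0) := by
  refine iSup_le fun t => (h.dependence_shift k t).trans ?_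
  refine iSup₂_le fun G hG => iSup₂_le fun H hH => ?_
  exact le_iSup₂_of_le G hG (le_iSup₂_of_le H (sigmaAt_le_sigmaPast X le_rfl _ hH) le_rfl)

end Stationary

/-! ### The explicit mixing bound. -/

section ARCH

variable {Ω : Type*} [MeasurableSpace Ω] {P : Measure Ω} [IsProbabilityMeasure P] {a : ℕ → ℝ}
  {Z X : ℤ → Ω → ℝ} {f : ℝ → ℝ} {L ν : ℝ}

/-- Since `ν / (ν + 1) = ν * (1 / (ν + 1))`, this is Jensen for `|X| ^ ν` with exponent `1 / (ν +
1)`. -/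
theorem IsStrictlyStationary.lintegral_rpow_le (hstat : IsStrictlyStationary P X)
    (hX : ∀ t, Measurable (X t)) (hν : 1 < ν) (hmom : Integrable (fun ω => |X 0 ω| ^ ν) P)
    (t : ℤ) : ∫⁻ ω, ‖X t ω‖ₑ ^ (ν / (ν + 1)) ∂P ≤
      ENNReal.ofReal ((∫ ω, |X 0 ω| ^ ν ∂P) ^ (1 / (ν + 1))) := by
  have h0 : 0 ≤ ∫ ω, |X 0 ω| ^ ν ∂P := integral_nonneg fun ω => by positivity
  have hstat' : ∫⁻ ω, ‖X t ω‖ₑ ^ (ν / (ν + 1)) ∂P = ∫⁻ ω, ‖X 0 ω‖ₑ ^ (ν / (ν + 1)) ∂P :=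
    ((hstat.identDistrib t).comp (measurable_enorm.pow_const (ν / (ν + 1)))).lintegral_eq
  have h1 : ∫⁻ ω, ‖X 0 ω‖ₑ ^ ν ∂P = ENNReal.ofReal (∫ ω, |X 0 ω| ^ ν ∂P) := by
    rw [ofReal_integral_eq_lintegral_ofReal hmom (ae_of_all _ fun ω => by positivity)]
    refine lintegral_congr fun ω => ?_
    rw [← ENNReal.ofReal_rpow_of_nonneg (abs_nonneg _) (by linarith), Real.enorm_eq_ofReal_abs]
  rw [hstat', ← ENNReal.ofReal_rpow_of_nonneg h0 (by positivity), ← h1]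
  have h2 := lintegral_rpow_le_rpow_lintegral P
    ((hX 0).enorm.pow_const ν).aemeasurable (p := 1 / (ν + 1)) (by positivity)
    (by rw [div_lt_one (by linarith)]; linarith)
  simp_rw [← ENNReal.rpow_mul, mul_one_div] at h2
  exact h2

theorem IsARCHInfty.dependence_le (hX : IsARCHInfty P a Z X) (hstat : IsStrictlyStationary P X)
    (hf : IsDensityOf P (Z 0) f) (hL : ScaleLipschitz f L) (hν : 1 < ν)
    (hmom : Integrable (fun ω => |X 0 ω| ^ ν) P) {k : ℕ} (hk : 1 ≤ k) :
    dependence P (sigmaAt X k) (sigmaPast X 0) ≤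
      ENNReal.ofReal (constK ν * L ^ (ν / (ν + 1))) *
        ∑' i : ℕ, ENNReal.ofReal
          (((1 / a 0) * ∑ j ∈ Finset.range k, |psi a j| * a (k - j + i)) ^ (ν / (ν + 1)) *
            (∫ ω, |X 0 ω| ^ ν ∂P) ^ (1 / (ν + 1))) := by
  obtain ⟨m, rfl⟩ : ∃ m, k = m + 1 := ⟨k - 1, by omega⟩
  have hL1 := hf.one_le_of_scaleLipschitz (hX.measurable_Z 0) hL
  have ha0 := hX.a_pos 0
  have hp : 0 < ν / (ν + 1) := by positivity
  have hp1 : ν / (ν + 1) < 1 := by rw [div_lt_one (by linarith)]; linarith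
  set p := ν / (ν + 1)
  have h := hX.dependence_le_tsum hf hL hp hp1.le m
  rw [← ENNReal.tsum_mul_left] at h ⊢
  push_cast
  refine h.trans (ENNReal.tsum_le_tsum fun i => ?_)
  set c := ∑ j ∈ Finset.range (m + 1), |psi a j| * a (m + 1 - j + i) with hc
  have hc0 : 0 ≤ c := Finset.sum_nonneg fun j _ => mul_nonneg (abs_nonneg _) (hX.a_pos _).le
  have hT : ∫⁻ ω, volterra (fun j => ENNReal.ofReal (a j))
      (fun m => ENNReal.ofReal (a (m + 1 + i))) (fun i => ‖Z (i + 1) ω‖ₑ) m ^ p ∂P ≤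
      ENNReal.ofReal (c ^ p) := by
    have hm := measurable_volterra (z := fun i ω => ‖Z (i + 1) ω‖ₑ) (n := m)
      (fun j => ENNReal.ofReal (a j)) (fun m => ENNReal.ofReal (a (m + 1 + i)))
      fun j _ => (hX.measurable_Z (j + 1)).enorm
    refine (lintegral_rpow_le_rpow_lintegral P hm.aemeasurable hp hp1).trans ?_
    rw [hX.lintegral_volterra, volterra_one_eq (fun j => (hX.a_pos j).le)
      (b := fun m => a (m + 1 + i)) (fun j => (hX.a_pos _).le),
      ENNReal.ofReal_rpow_of_nonneg _ hp.le]
    · refine ENNReal.ofReal_le_ofReal (le_of_eq ?_)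
      congr 1
      refine Finset.sum_congr rfl fun j hj => ?_
      have := Finset.mem_range.1 hj
      rw [show m - j + 1 + i = m + 1 - j + i by omega]
    · exact Finset.sum_nonneg fun j _ => mul_nonneg (abs_nonneg _) (hX.a_pos _).le
  -- The argument produces the factor `2 ^ p ≤ 2`, and `constK ν` is at least 3.
  have hK : (2 * L / a 0) ^ p ≤ constK ν * L ^ p * (1 / a 0) ^ p := by
    rw [show 2 * L / a 0 = 2 * L * (1 / a 0) by ring, Real.mul_rpow (by positivity) (by positivity),
      Real.mul_rpow (by positivity) (by positivity)]
    gcongr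
    calc (2 : ℝ) ^ p ≤ 2 ^ (1 : ℝ) := Real.rpow_le_rpow_of_exponent_le (by norm_num) hp1.le
      _ ≤ constK ν := by rw [Real.rpow_one]; linarith [three_le_constK hν]
  have hK0 : 0 ≤ constK ν := by linarith [three_le_constK hν]
  calc _ ≤ ENNReal.ofReal (2 * L / a 0) ^ p * (ENNReal.ofReal (c ^ p) *
        ENNReal.ofReal ((∫ ω, |X 0 ω| ^ ν ∂P) ^ (1 / (ν + 1)))) := by
        gcongr
        exact hstat.lintegral_rpow_le hX.measurable_X hν hmom _
    _ ≤ ENNReal.ofReal (constK ν * L ^ p * (1 / a 0) ^ p) * (ENNReal.ofReal (c ^ p) *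
        ENNReal.ofReal ((∫ ω, |X 0 ω| ^ ν ∂P) ^ (1 / (ν + 1)))) := by
        rw [ENNReal.ofReal_rpow_of_nonneg (by positivity) hp.le]
        gcongr
    _ = _ := by
        rw [Real.mul_rpow (by positivity) hc0, ← ENNReal.ofReal_mul (by positivity),
          ← ENNReal.ofReal_mul (by positivity), ← ENNReal.ofReal_mul (by positivity)]
        congr 1
        ring

end ARCH

/-! ### Polynomial decay of the convolution. -/

theorem ENNReal.tsum_eq_tsum_sum_mod (g : ℕ → ℝ≥0∞) (n : ℕ) [NeZero n] :
    ∑' i, g i = ∑' l, ∑ r : Fin n, g (l * n + r) := by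
  have h : ∑' i, g i = ∑' c : ℕ × Fin n, g (c.1 * n + c.2) := by
    rw [← (Nat.divModEquiv n).symm.tsum_eq]
    simp only [Nat.divModEquiv_symm_apply]
  rw [h, ENNReal.tsum_prod (f := fun l (r : Fin n) => g (l * n + r))]
  exact tsum_congr fun l => tsum_fintype _

/-- Cut the sum into blocks of length `n`: in block `l` each of the `n` terms has base at least `n *
(l + 1)`. -/
theorem tsum_ofReal_add_rpow_neg_le {q : ℝ} (hq : 1 < q) {n : ℕ} (hn : 1 ≤ n) :
    ∑' i : ℕ, ENNReal.ofReal (((n + i : ℕ) : ℝ) ^ (-q)) ≤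
      ENNReal.ofReal ((∑' l : ℕ, ((l + 1 : ℕ) : ℝ) ^ (-q)) * (n : ℝ) ^ (1 - q)) := by
  have : NeZero n := ⟨by omega⟩
  have hn0 : (0 : ℝ) < n := by positivity
  have hs : Summable fun l : ℕ => ((l + 1 : ℕ) : ℝ) ^ (-q) :=
    (summable_nat_add_iff 1).2 (Real.summable_nat_rpow.2 (by linarith))
  rw [ENNReal.tsum_eq_tsum_sum_mod _ n,
    ENNReal.ofReal_mul (tsum_nonneg fun l => by positivity),
    ENNReal.ofReal_tsum_of_nonneg (fun l => by positivity) hs, ← ENNReal.tsum_mul_right]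
  refine ENNReal.tsum_le_tsum fun l => ?_
  have h : ∀ r : Fin n, ENNReal.ofReal (((n + (l * n + r) : ℕ) : ℝ) ^ (-q)) ≤
      ENNReal.ofReal (((l + 1 : ℕ) : ℝ) ^ (-q) * (n : ℝ) ^ (-q)) := by
    intro r
    rw [← Real.mul_rpow (by positivity) (by positivity)]
    refine ENNReal.ofReal_le_ofReal
      (Real.rpow_le_rpow_of_nonpos (by positivity) ?_ (by linarith))
    push_cast
    nlinarith [(Nat.cast_nonneg (r : ℕ) : (0 : ℝ) ≤ (r : ℕ))]
  refine (Finset.sum_le_sum fun r _ => h r).trans (le_of_eq ?_)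
  rw [Finset.sum_const, Finset.card_univ, Fintype.card_fin, nsmul_eq_mul,
    ← ENNReal.ofReal_natCast, ← ENNReal.ofReal_mul (by positivity),
    ← ENNReal.ofReal_mul (by positivity)]
  congr 1
  rw [sub_eq_add_neg, Real.rpow_add hn0, Real.rpow_one]
  ring

/-- The shift to `j + 1` makes the bound valid at `j = 0` as well; it costs `2 ^ δ` because `j + 1 ≤
2 * j` for `j ≥ 1`. -/
theorem exists_le_mul_rpow_of_isBigO {u : ℕ → ℝ} {δ : ℝ} (hδ : 0 ≤ δ)
    (hu : u =O[atTop] fun j : ℕ => (j : ℝ) ^ (-δ)) :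
    ∃ C : ℝ, 0 < C ∧ ∀ j : ℕ, |u j| ≤ C * ((j : ℝ) + 1) ^ (-δ) := by
  have h : u =O[atTop] fun j : ℕ => ((j : ℝ) + 1) ^ (-δ) := by
    refine hu.trans (IsBigO.of_bound (2 ^ δ) ?_)
    filter_upwards [eventually_ge_atTop 1] with j hj
    have hj : (1 : ℝ) ≤ j := by exact_mod_cast hj
    rw [Real.norm_of_nonneg (by positivity), Real.norm_of_nonneg (by positivity),
      Real.rpow_neg (by positivity), Real.rpow_neg (by positivity), ← div_eq_mul_inv,
      ← Real.div_rpow (by norm_num) (by positivity), ← Real.inv_rpow (by positivity)]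
    refine Real.rpow_le_rpow (by positivity) ?_ hδ
    rw [inv_le_comm₀ (by positivity) (by positivity), inv_div]
    linarith
  obtain ⟨C, hC, hb⟩ := bound_of_isBigO_nat_atTop h
  refine ⟨C, hC, fun j => ?_⟩
  have h0 : 0 < ((j : ℝ) + 1) ^ (-δ) := by positivity
  simpa [abs_of_pos h0] using hb h0.ne'

theorem exists_tsum_convolution_rpow_le {u v : ℕ → ℝ} {δ p c : ℝ} (hp : 0 < p) (hp1 : p ≤ 1)
    (hq : 1 < δ * p) (hc : 0 < c) (hv : ∀ j, 0 ≤ v j)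
    (hu : u =O[atTop] fun j : ℕ => (j : ℝ) ^ (-δ))
    (hvO : v =O[atTop] fun j : ℕ => (j : ℝ) ^ (-δ)) :
    ∃ K : ℝ, 0 ≤ K ∧ ∀ k : ℕ, 1 ≤ k →
      ∑' i : ℕ, ENNReal.ofReal ((c * ∑ j ∈ Finset.range k, |u j| * v (k - j + i)) ^ p) ≤
        ENNReal.ofReal (K * (k * ((k : ℝ) + 1) ^ (-(δ * p) + 1))) := by
  have hδ : 0 ≤ δ := (pos_of_mul_pos_left (by linarith) hp.le).le
  obtain ⟨C, hC, hub⟩ := exists_le_mul_rpow_of_isBigO hδ hu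
  obtain ⟨C', hC', hvb⟩ := exists_le_mul_rpow_of_isBigO hδ hvO
  set q := δ * p with hq'
  set D := ∑' l : ℕ, ((l + 1 : ℕ) : ℝ) ^ (-q) with hD
  have hD0 : 0 ≤ D := tsum_nonneg fun l => by positivity
  set M := (c * (C * C')) ^ p with hM
  have hM0 : 0 ≤ M := by positivity
  refine ⟨M * (D * 2 ^ (q - 1)), by positivity, fun k hk => ?_⟩
  have hterm : ∀ i j, j < k → ENNReal.ofReal (c * (|u j| * v (k - j + i))) ^ p ≤
      ENNReal.ofReal (M * ((j : ℝ) + 1) ^ (-q)) *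
        ENNReal.ofReal (((k - j + i : ℕ) : ℝ) ^ (-q)) := by
    intro i j hj
    have hn : (0 : ℝ) < (k - j + i : ℕ) := by exact_mod_cast (by omega : 0 < k - j + i)
    rw [ENNReal.ofReal_rpow_of_nonneg (mul_nonneg hc.le (mul_nonneg (abs_nonneg _) (hv _))) hp.le,
      ← ENNReal.ofReal_mul (by positivity)]
    refine ENNReal.ofReal_le_ofReal ?_
    have hvb' : v (k - j + i) ≤ C' * ((k - j + i : ℕ) : ℝ) ^ (-δ) := by
      refine (le_abs_self _).trans ((hvb _).trans ?_)
      refine mul_le_mul_of_nonneg_left ?_ hC'.le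
      exact Real.rpow_le_rpow_of_nonpos hn (by linarith) (by linarith)
    calc (c * (|u j| * v (k - j + i))) ^ p
        ≤ (c * ((C * ((j : ℝ) + 1) ^ (-δ)) * (C' * ((k - j + i : ℕ) : ℝ) ^ (-δ)))) ^ p := by
          refine Real.rpow_le_rpow (mul_nonneg hc.le (mul_nonneg (abs_nonneg _) (hv _))) ?_ hp.le
          exact mul_le_mul_of_nonneg_left
            (mul_le_mul (hub j) hvb' (hv _) (by positivity)) hc.le
      _ = (c * (C * C') * (((j : ℝ) + 1) ^ (-δ) * ((k - j + i : ℕ) : ℝ) ^ (-δ))) ^ p := by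
          congr 1; ring
      _ = M * ((j : ℝ) + 1) ^ (-q) * ((k - j + i : ℕ) : ℝ) ^ (-q) := by
          rw [Real.mul_rpow (x := c * (C * C')) (by positivity) (by positivity), ← hM,
            Real.mul_rpow (by positivity) (by positivity), ← Real.rpow_mul (by positivity),
            ← Real.rpow_mul (by positivity), neg_mul, ← hq', mul_assoc]
  have hpow : ∀ j ∈ Finset.range k, M * ((j : ℝ) + 1) ^ (-q) * (D * ((k - j : ℕ) : ℝ) ^ (1 - q)) ≤
      M * (D * 2 ^ (q - 1)) * ((k : ℝ) + 1) ^ (-q + 1) := by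
    intro j hj
    have hj := Finset.mem_range.1 hj
    have hn : (1 : ℝ) ≤ (k - j : ℕ) := by exact_mod_cast (by omega : 1 ≤ k - j)
    have hkj : (k : ℝ) = j + (k - j : ℕ) := by exact_mod_cast (by omega : k = j + (k - j))
    have hk1 : (1 : ℝ) ≤ k := by exact_mod_cast hk
    -- Giving up a factor `j + 1` puts both bases under the same exponent `1 - q`; each of the `k`
    -- terms then obeys one bound free of `j`, whence the factor `k` in the rate.
    have h1 : ((j : ℝ) + 1) ^ (-q) ≤ ((j : ℝ) + 1) ^ (1 - q) :=
      Real.rpow_le_rpow_of_exponent_le (by linarith [(Nat.cast_nonneg j : (0 : ℝ) ≤ j)])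
        (by linarith)
    have h2 : ((j : ℝ) + 1) ^ (1 - q) * ((k - j : ℕ) : ℝ) ^ (1 - q) ≤
        2 ^ (q - 1) * ((k : ℝ) + 1) ^ (-q + 1) := by
      rw [← Real.mul_rpow (by positivity) (by positivity), show -q + 1 = 1 - q by ring,
        show q - 1 = -(1 - q) by ring, Real.rpow_neg (by norm_num), ← Real.inv_rpow (by norm_num),
        ← Real.mul_rpow (by positivity) (by positivity)]
      refine Real.rpow_le_rpow_of_nonpos (by positivity) ?_ (by linarith)
      -- This is `(k + 1) / 2 ≤ (j + 1) * (k - j)`, the source of the constant `2 ^ (q - 1)`.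
      nlinarith [mul_nonneg (Nat.cast_nonneg j : (0 : ℝ) ≤ j) (sub_nonneg.2 hn)]
    calc _ ≤ M * ((j : ℝ) + 1) ^ (1 - q) * (D * ((k - j : ℕ) : ℝ) ^ (1 - q)) := by gcongr
      _ = M * D * (((j : ℝ) + 1) ^ (1 - q) * ((k - j : ℕ) : ℝ) ^ (1 - q)) := by ring
      _ ≤ M * D * (2 ^ (q - 1) * ((k : ℝ) + 1) ^ (-q + 1)) := by gcongr
      _ = _ := by ring
  calc ∑' i : ℕ, ENNReal.ofReal ((c * ∑ j ∈ Finset.range k, |u j| * v (k - j + i)) ^ p)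
      ≤ ∑' i : ℕ, ∑ j ∈ Finset.range k, ENNReal.ofReal (M * ((j : ℝ) + 1) ^ (-q)) *
          ENNReal.ofReal (((k - j + i : ℕ) : ℝ) ^ (-q)) := by
        refine ENNReal.tsum_le_tsum fun i => ?_
        have hnn : ∀ j, 0 ≤ |u j| * v (k - j + i) := fun j => mul_nonneg (abs_nonneg _) (hv _)
        rw [← ENNReal.ofReal_rpow_of_nonneg
          (mul_nonneg hc.le (Finset.sum_nonneg fun j _ => hnn j)) hp.le, Finset.mul_sum,
          ENNReal.ofReal_sum_of_nonneg fun j _ => mul_nonneg hc.le (hnn j)]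
        exact (ENNReal.rpow_sum_le_sum_rpow _ _ hp hp1).trans
          (Finset.sum_le_sum fun j hj => hterm i j (Finset.mem_range.1 hj))
    _ = ∑ j ∈ Finset.range k, ENNReal.ofReal (M * ((j : ℝ) + 1) ^ (-q)) *
          ∑' i : ℕ, ENNReal.ofReal (((k - j + i : ℕ) : ℝ) ^ (-q)) := by
        rw [Summable.tsum_finsetSum fun _ _ => ENNReal.summable]
        simp_rw [ENNReal.tsum_mul_left]
    _ ≤ ∑ j ∈ Finset.range k,
          ENNReal.ofReal (M * (D * 2 ^ (q - 1)) * ((k : ℝ) + 1) ^ (-q + 1)) := by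
        refine Finset.sum_le_sum fun j hj => ?_
        have hj' := Finset.mem_range.1 hj
        refine (mul_le_mul_right (tsum_ofReal_add_rpow_neg_le hq (by omega)) _).trans ?_
        rw [← ENNReal.ofReal_mul (by positivity)]
        exact ENNReal.ofReal_le_ofReal (hpow j hj)
    _ = _ := by
        rw [Finset.sum_const, Finset.card_range, nsmul_eq_mul, ← ENNReal.ofReal_natCast,
          ← ENNReal.ofReal_mul (by positivity)]
        congr 1
        ring

theorem theorem4p2 {Ω : Type*} [MeasurableSpace Ω] (P : Measure Ω) [IsProbabilityMeasure P]
    (a : ℕ → ℝ) (Z X : ℤ → Ω → ℝ) (f : ℝ → ℝ) (L ν : ℝ)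
    (hX : IsARCHInfty P a Z X) (hstat : IsStrictlyStationary P X)
    (hf : IsDensityOf P (Z 0) f) (hL : ScaleLipschitz f L)
    (ha : SummableBelowOne a)
    (hν : 1 < ν) (hmom : ∀ t, Integrable (fun ω => |X t ω| ^ ν) P) :
    (∀ k : ℕ, 1 ≤ k →
      dependence P (sigmaAt X k) (sigmaPast X 0) ≤
        ENNReal.ofReal (constK ν * L ^ (ν / (ν + 1))) *
          ∑' i : ℕ, ENNReal.ofReal
            (((1 / a 0) * ∑ j ∈ Finset.range k, |psi a j| * a (k - j + i)) ^ (ν / (ν + 1)) *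
              (∫ ω, |X 0 ω| ^ ν ∂P) ^ (1 / (ν + 1)))) ∧
    (∀ δ : ℝ,
      a =Θ[atTop] (fun j : ℕ => (j : ℝ) ^ (-δ)) →
      (fun j : ℕ => |psi a j|) =Θ[atTop] (fun j : ℕ => (j : ℝ) ^ (-δ)) →
      ∃ K : ℝ, ∀ k : ℕ, 1 ≤ k →
        dependence P (sigmaAt X k) (sigmaPast X 0) ≤
            ENNReal.ofReal (K * (k * ((k : ℝ) + 1) ^ (-(δ * (ν / (ν + 1))) + 1))) ∧
        twoMixingRate P X k ≤
            ENNReal.ofReal (K * (k * ((k : ℝ) + 1) ^ (-(δ * (ν / (ν + 1))) + 1)))) := by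
  have hfirst : ∀ k : ℕ, 1 ≤ k → _ := fun k hk =>
    hX.dependence_le hstat hf hL hν (hmom 0) hk
  refine ⟨hfirst, fun δ haδ hψδ => ?_⟩
  have hp : 0 < ν / (ν + 1) := by positivity
  have hp1 : ν / (ν + 1) ≤ 1 := by rw [div_le_one (by linarith)]; linarith
  have hmix := hstat.twoMixingRate_le
  suffices h : ∃ K : ℝ, ∀ k : ℕ, 1 ≤ k → dependence P (sigmaAt X k) (sigmaPast X 0) ≤
      ENNReal.ofReal (K * (k * ((k : ℝ) + 1) ^ (-(δ * (ν / (ν + 1))) + 1))) by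
    obtain ⟨K, hK⟩ := h
    exact ⟨K, fun k hk => ⟨hK k hk, (hmix k).trans (hK k hk)⟩⟩
  -- For `δ * (ν / (ν + 1)) ≤ 1` both factors of the rate are at least 1, so `K = 1` works because
  -- the dependence never exceeds 1.
  rcases le_or_gt (δ * (ν / (ν + 1))) 1 with hq | hq
  · refine ⟨1, fun k hk => (dependence_le_one _ _ P).trans ?_⟩
    have hk : (1 : ℝ) ≤ k := by exact_mod_cast hk
    rw [one_mul, ENNReal.one_le_ofReal]
    exact one_le_mul_of_one_le_of_one_le hk (Real.one_le_rpow (by linarith) (by linarith))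
  · obtain ⟨K, hK0, hK⟩ := exists_tsum_convolution_rpow_le hp hp1 hq
      (one_div_pos.2 (hX.a_pos 0)) (fun j => (hX.a_pos j).le) hψδ.isBigO.of_abs_left haδ.isBigO
    set E := (∫ ω, |X 0 ω| ^ ν ∂P) ^ (1 / (ν + 1)) with hE
    have hE0 : 0 ≤ E := Real.rpow_nonneg (integral_nonneg fun ω => by positivity) _
    have hL1 := hf.one_le_of_scaleLipschitz (hX.measurable_Z 0) hL
    have hC0 : 0 ≤ constK ν * L ^ (ν / (ν + 1)) :=
      mul_nonneg (by linarith [three_le_constK hν]) (by positivity)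
    refine ⟨constK ν * L ^ (ν / (ν + 1)) * (K * E), fun k hk => (hfirst k hk).trans ?_⟩
    simp_rw [ENNReal.ofReal_mul' hE0]
    rw [ENNReal.tsum_mul_right]
    refine (mul_le_mul_right (mul_le_mul_left (hK k hk) _) _).trans (le_of_eq ?_)
    rw [← ENNReal.ofReal_mul (by positivity), ← ENNReal.ofReal_mul hC0]
    congr 1
    ring
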